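/- Let $\mathcal H$ be a real Hilbert space and let $F\colon\mathcal H\to\mathbb R$ be convex and differentiable with a $\beta$-Lipschitz continuous gradient, for some $\beta>0$. Let $G\colon\mathcal H\to\,]-\infty,+\infty]$ be proper, lower semicontinuous and convex, set $J=F+G$, and suppose that the set $\operatorname{Argmin}J$ of minimizers of $J$ is nonempty. Let $(\gamma_m)_{m\in\mathbb N}$ be positive reals with $0<\inf_m\gamma_m\le\sup_m\gamma_m<2/\beta$, let $(\tau_m)_{m\in\mathbb N}$ be a sequence in $]0,1]$ with $\inf_m\tau_m>0$, let $(\delta_m)_{m\in\mathbb N}$ be a summable sequence in $[0,+\infty[$, and let $(b_m)_{m\in\mathbb N}$ be a sequence in $\mathcal H$ with $\sum_m\|b_m\|<+\infty$. Let $u_0\in\mathcal H$ and let $(u_m)_{m\in\mathbb N}$, $(v_m)_{m\in\mathbb N}$ be sequences in $\mathcal H$ such that, for every $m\in\mathbb N$, with $w_m=u_m-\gamma_m(\nabla F(u_m)+b_m)$, $$\gamma_mG(v_m)+\tfrac12\|v_m-w_m\|^2\le\inf_{v\in\mathcal H}\Big(\gamma_mG(v)+\tfrac12\|v-w_m\|^2\Big)+\frac{\delta_m^2}{2},\qquad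 u_{m+1}=u_m+\tau_m(v_m-u_m).$$ Then the following hold. 1. $(u_m)$ converges weakly to a point of $\operatorname{Argmin}J$. 2. For every $u\in\operatorname{Argmin}J$, $\sum_m\|\nabla F(u_m)-\nabla F(u)\|^2<+\infty$. 3. $\sum_m\|v_m-u_m\|^2<+\infty$. 4. If $J(u_k)<+\infty$ for some $k\in\mathbb N$ (for instance if $J(u_0)<+\infty$), then $J(u_m)<+\infty$ for all $m\ge k$ and $J(u_m)\to\inf J$. In all cases $J(v_m)<+\infty$ for every $m$ and $\sum_m|J(v_m)-\inf J|^2<+\infty$. 5. If $\sum_m(1-\tau_m)<+\infty$, then $\sum_m(J(v_m)-\inf J)<+\infty$ and, for every $k\in\mathbb N$ with $J(u_k)<+\infty$, $\sum_{m\ge k}(J(u_m)-\inf J)<+\infty$. 6. If $\sum_m(1-\tau_m)<+\infty$, $\sum_m m\,\delta_m<+\infty$, $\sum_m m\|b_m\|<+\infty$, and $J(u_k)<+\infty$ for some $k\in\mathbb N$, then $J(u_m)-\inf J=o(1/m)$ as $m\to+\infty$. -/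

import Mathlib

open Filter Topology Set

noncomputable section

/-- The class `Γ₀(H)` of proper lower semicontinuous convex functions from `H` to `]-∞, +∞]`.
Since the value `⊥` is excluded, the sum and the products in `convex` are the usual ones of
`]-∞, +∞]`, with the convention `0 * ⊤ = 0`. -/
structure IsGammaZero {H : Type*} [NormedAddCommGroup H] [InnerProductSpace ℝ H]
    (φ : H → EReal) : Prop where
  ne_bot : ∀ x, φ x ≠ ⊥
  proper : ∃ x, φ x ≠ ⊤
  lsc : LowerSemicontinuous φ
  convex : ∀ x y : H, ∀ a b : ℝ, 0 ≤ a → 0 ≤ b → a + b = 1 →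
    φ (a • x + b • y) ≤ (a : EReal) * φ x + (b : EReal) * φ y

/-- `IsApproxProx φ δ w u` means `u ≃_δ prox_φ w`: the point `u` minimizes
`v ↦ φ v + ‖v - w‖² / 2` up to `δ² / 2`. -/
def IsApproxProx {H : Type*} [NormedAddCommGroup H] [InnerProductSpace ℝ H]
    (φ : H → EReal) (δ : ℝ) (w u : H) : Prop :=
  φ u + ((1 / 2 * ‖u - w‖ ^ 2 : ℝ) : EReal) ≤
    (⨅ v : H, (φ v + ((1 / 2 * ‖v - w‖ ^ 2 : ℝ) : EReal))) + ((δ ^ 2 / 2 : ℝ) : EReal)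

/-- The set of minimizers of `φ` over `H`. -/
def Argmin {H : Type*} (φ : H → EReal) : Set H := {u | ∀ v, φ u ≤ φ v}

/-- The objective gap `φ x - inf φ`, as a real number. It is meaningful when `φ x` and `inf φ` are
finite. -/
def objGap {H : Type*} (φ : H → EReal) (x : H) : ℝ := (φ x - ⨅ y, φ y).toReal

end

/-! Everything follows from one energy inequality. Testing the approximate proximal step at x in dom
G gives z + ‖v - x‖²/2 ≤ ‖u - x‖²/2 + δ²/2 + e‖v - x‖ with the summable error e = δ + γ‖b‖, where z
takes two forms. If x is a minimizer, cocoercivity of ∇F makes z at least a quadratic form in ‖v -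
u‖ and ‖∇F(u) - ∇F(x)‖, positive definite because sup γ < 2/β
(`ConvexOn.forwardBackward_residual_le`, `exists_pos_mul_add_sq_le`). Then (u_m) is quasi-Fejér and
both quantities are square summable (`quasiFejer`). For any x in dom G, the descent lemma gives z =
γ(J(v) - J(x)) + (1 - γβ)‖v - u‖²/2 (`ConvexOn.forwardBackward_gap_le`). At a minimizer this bounds
the gap at v by O(‖v - u‖ + e), hence in ℓ²; if 1 - τ is summable, the energy telescopes and the gap
is in ℓ¹. Convexity transfers this from v_m to u_m. At x = u_m it shows that J(u_m) is nonincreasing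
up to errors O(e), and a summable sequence of this kind is o(1/m). Weak convergence is Opial's
lemma: J(v_m) → inf J and v_m - u_m → 0 put weak cluster points in every sublevel set above inf J.
-/

/-! ### Real sequences with summable errors -/

theorem summable_and_tendsto_of_add_le {a c e : ℕ → ℝ} (ha : ∀ n, 0 ≤ a n) (hc : ∀ n, 0 ≤ c n)
    (he : ∀ n, 0 ≤ e n) (hes : Summable e) (h : ∀ n, a (n + 1) + c n ≤ a n + e n) :
    Summable c ∧ ∃ l, Tendsto a atTop (𝓝 l) := by
  have hS : ∀ n, ∑ i ∈ Finset.range n, e i ≤ ∑' i, e i := fun n =>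
    hes.sum_le_tsum _ fun i _ => he i
  constructor
  · refine summable_of_sum_range_le (c := a 0 + ∑' i, e i) hc fun n => ?_
    have : a n + ∑ i ∈ Finset.range n, c i ≤ a 0 + ∑ i ∈ Finset.range n, e i := by
      induction n with
      | zero => simp
      | succ n ih =>
        rw [Finset.sum_range_succ, Finset.sum_range_succ]
        linarith [h n]
    linarith [ha n, hS n]
  · have hanti : Antitone fun n => a n - ∑ i ∈ Finset.range n, e i := by
      refine antitone_nat_of_succ_le fun n => ?_
      rw [Finset.sum_range_succ]
      linarith [h n, hc n]
    have hbdd : BddBelow (range fun n => a n - ∑ i ∈ Finset.range n, e i) := by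
      refine ⟨-∑' i, e i, ?_⟩
      rintro _ ⟨n, rfl⟩
      show _ ≤ a n - ∑ i ∈ Finset.range n, e i
      linarith [ha n, hS n]
    have h1 := (tendsto_atTop_ciInf hanti hbdd).add hes.hasSum.tendsto_sum_nat
    exact ⟨_, h1.congr fun n => by ring⟩

theorem summable_of_le_contraction {a e : ℕ → ℝ} {t : ℝ} (ht : 0 < t) (ha : ∀ n, 0 ≤ a n)
    (he : ∀ n, 0 ≤ e n) (hes : Summable e) (h : ∀ n, a (n + 1) ≤ (1 - t) * a n + e n) :
    Summable a := by
  have := (summable_and_tendsto_of_add_le (c := fun n => t * a n) ha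
    (fun n => mul_nonneg ht.le (ha n)) he hes fun n => by linarith [h n]).1
  exact (summable_mul_left_iff ht.ne').1 this

/-- A nonnegative summable sequence which is nonincreasing up to errors `e n` with
`∑ n e n < ∞` is `o(1 / n)`. -/
theorem tendsto_mul_of_summable_of_almost_antitone {a e : ℕ → ℝ} (ha : ∀ n, 0 ≤ a n)
    (he : ∀ n, 0 ≤ e n) (has : Summable a) (hes : Summable fun n : ℕ => ((n : ℝ) + 1) * e n)
    (h : ∀ n, a (n + 1) ≤ a n + e n) : Tendsto (fun n : ℕ => (n : ℝ) * a n) atTop (𝓝 0) := by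
  -- Since (n+1) a (n+1) ≤ n a n + a n + (n+1) e n, the sequence n a n converges; a limit l > 0
  -- would eventually force a n ≥ l/(2n), against divergence of the harmonic series.
  obtain ⟨-, l, hl⟩ := summable_and_tendsto_of_add_le (a := fun n : ℕ => (n : ℝ) * a n)
    (c := fun _ => 0) (e := fun n : ℕ => a n + ((n : ℝ) + 1) * e n)
    (fun n => mul_nonneg n.cast_nonneg (ha n)) (fun _ => le_rfl)
    (fun n => add_nonneg (ha n) (mul_nonneg (by positivity) (he n))) (has.add hes) fun n => by
      push_cast
      nlinarith [mul_le_mul_of_nonneg_left (h n) (show (0 : ℝ) ≤ n + 1 by positivity)]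
  have hl0 : 0 ≤ l := ge_of_tendsto' hl fun n => mul_nonneg n.cast_nonneg (ha n)
  rcases hl0.eq_or_lt with rfl | hpos
  · exact hl
  exfalso
  obtain ⟨N, hN⟩ := eventually_atTop.1 (hl.eventually (lt_mem_nhds (half_lt_self hpos)))
  have h2 : Summable fun n : ℕ => (l / 2) * (1 / ((n + (N + 1) : ℕ) : ℝ)) := by
    refine Summable.of_nonneg_of_le (fun n => by positivity) (fun n => ?_)
      ((summable_nat_add_iff (N + 1)).2 has)
    have := hN (n + (N + 1)) (by omega)
    rw [mul_one_div, div_le_iff₀ (by positivity)]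
    linarith
  have h3 := (summable_mul_left_iff (half_pos hpos).ne').1 h2
  exact Real.not_summable_one_div_natCast
    ((summable_nat_add_iff (f := fun n : ℕ => 1 / (n : ℝ)) (N + 1)).1 h3)

theorem le_of_forall_le_add_mul {a b c : ℝ} (h : ∀ t ∈ Ioc (0 : ℝ) 1, a ≤ b + t * c) : a ≤ b := by
  have h1 : Tendsto (fun t : ℝ => b + t * c) (𝓝[>] 0) (𝓝 b) := by
    have : ContinuousWithinAt (fun t : ℝ => b + t * c) (Ioi 0) 0 := by fun_prop
    simpa [ContinuousWithinAt] using this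
  refine ge_of_tendsto h1 ?_
  filter_upwards [Ioc_mem_nhdsGT (zero_lt_one' ℝ)] with t ht using h t ht

/-! ### Convex functions and Lipschitz gradients -/

section SmoothConvex

variable {H : Type*} [NormedAddCommGroup H] [InnerProductSpace ℝ H]

theorem norm_sq_lineMap_sub (a b : H) (t : ℝ) :
    ‖(1 - t) • a + t • b‖ ^ 2 = (1 - t) * ‖a‖ ^ 2 + t * ‖b‖ ^ 2 - t * (1 - t) * ‖a - b‖ ^ 2 := by
  rw [norm_add_sq_real, norm_sub_sq_real, norm_smul, norm_smul, inner_smul_left, inner_smul_right,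
    mul_pow, mul_pow, Real.norm_eq_abs, Real.norm_eq_abs, sq_abs, sq_abs]
  simp
  ring

/-- An approximate minimizer of a strongly convex function `f + ‖· - w‖² / 2` satisfies the
strong convexity inequality of an exact one, up to an error. -/
theorem ConvexOn.add_sq_norm_le_of_approx_min {D : Set H} {f : H → ℝ} (hf : ConvexOn ℝ D f)
    {v w : H} {d : ℝ} (hd : 0 ≤ d) (hvD : v ∈ D)
    (hv : ∀ x ∈ D, f v + 1 / 2 * ‖v - w‖ ^ 2 ≤ f x + 1 / 2 * ‖x - w‖ ^ 2 + d ^ 2 / 2)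
    {x : H} (hx : x ∈ D) :
    f v + 1 / 2 * ‖v - w‖ ^ 2 + 1 / 2 * ‖v - x‖ ^ 2 ≤
      f x + 1 / 2 * ‖x - w‖ ^ 2 + d ^ 2 / 2 + d * ‖v - x‖ := by
  set r := ‖v - x‖ with hr
  have hr0 : 0 ≤ r := norm_nonneg _
  -- Compare v with the point (1 - t)v + tx of the segment to x.
  have key : ∀ t ∈ Ioc (0 : ℝ) 1, t * (f v + 1 / 2 * ‖v - w‖ ^ 2) + t * (1 - t) * (1 / 2 * r ^ 2) ≤
      t * (f x + 1 / 2 * ‖x - w‖ ^ 2) + d ^ 2 / 2 := by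
    intro t ht
    have h0 : 0 ≤ 1 - t := by linarith [ht.2]
    have h1 := hv _ (hf.1 hvD hx h0 ht.1.le (by ring))
    have h2 := hf.2 hvD hx h0 ht.1.le (by ring)
    have h3 : (1 - t) • v + t • x - w = (1 - t) • (v - w) + t • (x - w) := by
      module
    rw [h3, norm_sq_lineMap_sub, sub_sub_sub_cancel_right, ← hr] at h1
    simp only [smul_eq_mul] at h2
    linarith
  -- If r ≤ d, then r²/2 is absorbed by d r. Otherwise divide `key` by t: the loss t r²/2 + d²/(2t)
  -- is smallest at t = d/r, where it equals d r. For d = 0, let t → 0 instead.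
  rcases le_or_gt r d with h | h
  · have := hv x hx
    nlinarith
  rcases hd.eq_or_lt with rfl | hd'
  · have : 1 / 2 * r ^ 2 ≤
        f x + 1 / 2 * ‖x - w‖ ^ 2 - (f v + 1 / 2 * ‖v - w‖ ^ 2) := by
      refine le_of_forall_le_add_mul (c := 1 / 2 * r ^ 2) fun t ht => ?_
      refine le_of_mul_le_mul_left ?_ ht.1
      linarith [key t ht]
    linarith
  · have hr' : 0 < r := hd'.trans h
    have h1 := key (d / r) ⟨by positivity, (div_le_one hr').2 h.le⟩
    have ht : 0 < d / r := by positivity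
    refine le_of_mul_le_mul_left ?_ ht
    have h2 : d = d / r * r := by field_simp
    set t := d / r
    rw [h2] at h1 ⊢
    nlinarith [mul_nonneg ht.le (sq_nonneg (t * r))]

variable [CompleteSpace H] {F : H → ℝ}

theorem HasGradientAt.hasDerivAt_add_smul {x d g : H} {t : ℝ} (h : HasGradientAt F g (x + t • d)) :
    HasDerivAt (fun s : ℝ => F (x + s • d)) (inner ℝ g d) t := by
  have h1 : HasDerivAt (fun s : ℝ => x + s • d) d t := by
    simpa using ((hasDerivAt_id t).smul_const d).const_add x
  exact h.hasFDerivAt.comp_hasDerivAt t h1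

theorem ConvexOn.add_inner_gradient_le (hF : ConvexOn ℝ univ F) (hd : Differentiable ℝ F)
    (x y : H) : F x + inner ℝ (gradient F x) (y - x) ≤ F y := by
  have h0 : HasGradientAt F (gradient F x) (x + (0 : ℝ) • (y - x)) := by
    simpa using (hd x).hasGradientAt
  have h1 := h0.hasDerivAt_add_smul
  have h2 : ConvexOn ℝ univ fun s : ℝ => F (x + s • (y - x)) := by
    refine ⟨convex_univ, fun s _ t _ a b ha hb hab => ?_⟩
    have := hF.2 (mem_univ (x + s • (y - x))) (mem_univ (x + t • (y - x))) ha hb hab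
    convert this using 2
    obtain rfl : a = 1 - b := by linarith
    simp only [smul_eq_mul]
    module
  have h3 := h2.le_slope_of_hasDerivAt (mem_univ 0) (mem_univ 1) zero_lt_one h1
  rw [slope_def_field, one_smul, zero_smul, add_sub_cancel, add_zero, sub_zero, div_one] at h3
  linarith

/-- The descent lemma. -/
theorem le_add_inner_gradient_add_sq {β : NNReal} (hd : Differentiable ℝ F)
    (hL : LipschitzWith β (gradient F)) (x y : H) :
    F y ≤ F x + inner ℝ (gradient F x) (y - x) + β / 2 * ‖y - x‖ ^ 2 := by
  set d := y - x with hdd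
  -- The Lipschitz bound makes this derivative nonpositive on (0, 1); comparing the values at 0 and
  -- 1 gives the claim.
  have hder : ∀ t : ℝ, HasDerivAt
      (fun s : ℝ => F (x + s • d) - s * inner ℝ (gradient F x) d - s ^ 2 * (β / 2 * ‖d‖ ^ 2))
      (inner ℝ (gradient F (x + t • d)) d - inner ℝ (gradient F x) d - 2 * t * (β / 2 * ‖d‖ ^ 2))
      t := by
    intro t
    have h1 := (hd (x + t • d)).hasGradientAt.hasDerivAt_add_smul
    have h2 := (hasDerivAt_id t).mul_const (inner ℝ (gradient F x) d)
    have h3 := (hasDerivAt_pow 2 t).mul_const (β / 2 * ‖d‖ ^ 2)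
    exact ((h1.sub h2).sub h3).congr_deriv (by norm_num)
  have hanti : AntitoneOn
      (fun s : ℝ => F (x + s • d) - s * inner ℝ (gradient F x) d - s ^ 2 * (β / 2 * ‖d‖ ^ 2))
      (Icc 0 1) := by
    refine antitoneOn_of_deriv_nonpos (convex_Icc 0 1)
      (fun t _ => (hder t).continuousAt.continuousWithinAt)
      (fun t _ => (hder t).differentiableAt.differentiableWithinAt) fun t ht => ?_
    rw [interior_Icc] at ht
    rw [(hder t).deriv, ← inner_sub_left]
    have h1 := real_inner_le_norm (gradient F (x + t • d) - gradient F x) d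
    have h2 : ‖gradient F (x + t • d) - gradient F x‖ ≤ β * (t * ‖d‖) := by
      have := hL.norm_sub_le (x + t • d) x
      rwa [add_sub_cancel_left, norm_smul, Real.norm_of_nonneg ht.1.le] at this
    nlinarith [mul_le_mul_of_nonneg_right h2 (norm_nonneg d)]
  have := hanti (left_mem_Icc.2 zero_le_one) (right_mem_Icc.2 zero_le_one) zero_le_one
  simp only [one_smul, zero_smul, hdd, add_sub_cancel, add_zero] at this
  rw [hdd]
  linarith

/-- Evaluate F at y - q/β, with q the gradient difference: the tangent at x bounds it below, the
descent lemma at y bounds it above. -/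
theorem ConvexOn.add_inner_gradient_add_sq_le {β : NNReal} (hβ : 0 < β) (hF : ConvexOn ℝ univ F)
    (hd : Differentiable ℝ F) (hL : LipschitzWith β (gradient F)) (x y : H) :
    F x + inner ℝ (gradient F x) (y - x) + 1 / (2 * β) * ‖gradient F y - gradient F x‖ ^ 2 ≤
      F y := by
  set q := gradient F y - gradient F x with hq
  have hβ' : (0 : ℝ) < β := hβ
  have h1 := hF.add_inner_gradient_le hd x (y - (1 / (β : ℝ)) • q)
  have h2 := le_add_inner_gradient_add_sq hd hL y (y - (1 / (β : ℝ)) • q)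
  have h3 : y - (1 / (β : ℝ)) • q - x = (y - x) - (1 / (β : ℝ)) • q := by abel
  have h4 : y - (1 / (β : ℝ)) • q - y = - ((1 / (β : ℝ)) • q) := by abel
  have h5 : inner ℝ (gradient F y) q - inner ℝ (gradient F x) q = ‖q‖ ^ 2 := by
    rw [← inner_sub_left, ← hq, real_inner_self_eq_norm_sq]
  rw [h3, inner_sub_right, inner_smul_right] at h1
  rw [h4, inner_neg_right, inner_smul_right, norm_neg, norm_smul, mul_pow,
    Real.norm_of_nonneg (by positivity)] at h2
  have h6 : (β : ℝ) / 2 * ((1 / β) ^ 2 * ‖q‖ ^ 2) = 1 / (2 * β) * ‖q‖ ^ 2 := by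
    field_simp
  have h7 : 1 / (β : ℝ) * ‖q‖ ^ 2 = 2 * (1 / (2 * β) * ‖q‖ ^ 2) := by
    field_simp
  rw [← h5, mul_sub] at h7
  rw [h5] at h7
  rw [h6] at h2
  linarith

/-- The gradient of a convex function with `β`-Lipschitz gradient is `1 / β`-cocoercive. -/
theorem ConvexOn.sq_norm_sub_le_inner_gradient {β : NNReal} (hβ : 0 < β) (hF : ConvexOn ℝ univ F)
    (hd : Differentiable ℝ F) (hL : LipschitzWith β (gradient F)) (x y : H) :
    1 / β * ‖gradient F y - gradient F x‖ ^ 2 ≤ inner ℝ (gradient F y - gradient F x) (y - x) := by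
  have h1 := hF.add_inner_gradient_add_sq_le hβ hd hL x y
  have h2 := hF.add_inner_gradient_add_sq_le hβ hd hL y x
  rw [norm_sub_rev, ← neg_sub y x, inner_neg_right] at h2
  rw [inner_sub_left]
  have : 1 / (β : ℝ) * ‖gradient F y - gradient F x‖ ^ 2 =
      2 * (1 / (2 * β) * ‖gradient F y - gradient F x‖ ^ 2) := by
    field_simp
  linarith

/-- The optimality condition `-∇F(x) ∈ ∂g(x)` at a minimizer of `F + g`. -/
theorem ConvexOn.sub_inner_gradient_le_of_isMinOn {β : NNReal} (hd : Differentiable ℝ F)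
    (hL : LipschitzWith β (gradient F)) {D : Set H} {g : H → ℝ} (hg : ConvexOn ℝ D g) {x y : H}
    (hx : x ∈ D) (hy : y ∈ D) (hmin : ∀ z ∈ D, F x + g x ≤ F z + g z) :
    g x - inner ℝ (gradient F x) (y - x) ≤ g y := by
  -- Compare x with (1 - t)x + ty: the descent lemma costs only O(t²), which vanishes after division
  -- by t as t → 0.
  refine le_of_forall_le_add_mul (c := β / 2 * ‖y - x‖ ^ 2) fun t ht => ?_
  refine le_of_mul_le_mul_left ?_ ht.1
  have h0 : 0 ≤ 1 - t := by linarith [ht.2]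
  have h1 := hmin _ (hg.1 hx hy h0 ht.1.le (by ring))
  have h2 := hg.2 hx hy h0 ht.1.le (by ring)
  have h3 := le_add_inner_gradient_add_sq hd hL x ((1 - t) • x + t • y)
  have h4 : (1 - t) • x + t • y - x = t • (y - x) := by module
  rw [h4, inner_smul_right, norm_smul, mul_pow, Real.norm_of_nonneg ht.1.le] at h3
  simp only [smul_eq_mul] at h2
  linarith

end SmoothConvex

/-! ### Weak compactness and weak convergence -/

section Weak

variable {H : Type*} [NormedAddCommGroup H] [InnerProductSpace ℝ H]

theorem continuous_inner_toWeakSpace_symm (y : H) :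
    Continuous fun z : WeakSpace ℝ H => inner ℝ y ((toWeakSpace ℝ H).symm z) :=
  WeakBilin.eval_continuous (topDualPairing ℝ H).flip (innerSL ℝ y)

/-- Banach–Alaoglu in the dual, carried to H by the Riesz isomorphism, which is continuous from the
weak-* to the weak topology. -/
theorem isCompact_toWeakSpace_image_closedBall [CompleteSpace H] (r : ℝ) :
    IsCompact (toWeakSpace ℝ H '' Metric.closedBall 0 r) := by
  let e : WeakDual ℝ H → WeakSpace ℝ H := fun f =>
    toWeakSpace ℝ H ((InnerProductSpace.toDual ℝ H).symm (StrongDual.toWeakDual.symm f))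
  have he : Continuous e := by
    refine WeakBilin.continuous_of_continuous_eval _ fun g => ?_
    have : (fun f : WeakDual ℝ H => (topDualPairing ℝ H).flip (e f) g) =
        fun f => f ((InnerProductSpace.toDual ℝ H).symm g) := by
      funext f
      have h1 : (topDualPairing ℝ H).flip (e f) g =
        g ((InnerProductSpace.toDual ℝ H).symm (StrongDual.toWeakDual.symm f)) := rfl
      rw [h1, ← InnerProductSpace.toDual_symm_apply, real_inner_comm,
        InnerProductSpace.toDual_symm_apply]
      rfl
    rw [this]
    exact WeakDual.eval_continuous _
  refine ((WeakDual.isCompact_closedBall (𝕜 := ℝ) (E := H) 0 r).image he).of_isClosed_subset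
    ?_ ?_
  · rw [← Metric.isClosed_closedBall.closure_eq,
      (convex_closedBall (0 : H) r).toWeakSpace_closure ℝ]
    exact isClosed_closure
  · rintro _ ⟨x, hx, rfl⟩
    refine ⟨StrongDual.toWeakDual (InnerProductSpace.toDual ℝ H x), ?_, ?_⟩
    · simpa using hx
    · simp [e]

/-- **Opial's lemma**. -/
theorem exists_tendsto_toWeakSpace [CompleteSpace H] {S : Set H} {u : ℕ → H} (hS : S.Nonempty)
    (hconv : ∀ x ∈ S, ∃ l, Tendsto (fun m => ‖u m - x‖) atTop (𝓝 l))
    (hcl : ∀ z, MapClusterPt (toWeakSpace ℝ H z) atTop (fun m => toWeakSpace ℝ H (u m)) → z ∈ S) :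
    ∃ x ∈ S, Tendsto (fun m => toWeakSpace ℝ H (u m)) atTop (𝓝 (toWeakSpace ℝ H x)) := by
  obtain ⟨x₀, hx₀⟩ := hS
  obtain ⟨l, hl⟩ := hconv x₀ hx₀
  obtain ⟨R, hR⟩ := hl.bddAbove_range
  set K := toWeakSpace ℝ H '' Metric.closedBall 0 (R + ‖x₀‖) with hK
  have hKc : IsCompact K := isCompact_toWeakSpace_image_closedBall _
  have hmem : ∀ m, toWeakSpace ℝ H (u m) ∈ K := fun m => by
    refine mem_image_of_mem _ ?_
    rw [mem_closedBall_zero_iff]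
    have h1 : ‖u m - x₀‖ ≤ R := hR ⟨m, rfl⟩
    have h2 := norm_add_le (u m - x₀) x₀
    rw [sub_add_cancel] at h2
    linarith
  obtain ⟨x', -, hx'⟩ := hKc.exists_mapClusterPt (f := atTop)
    (u := fun m => toWeakSpace ℝ H (u m)) (tendsto_principal.2 (Eventually.of_forall hmem))
  obtain ⟨x, rfl⟩ := (toWeakSpace ℝ H).surjective x'
  refine ⟨x, hcl x hx', hKc.tendsto_nhds_of_unique_mapClusterPt (Eventually.of_forall hmem) ?_⟩
  rintro _ ⟨y, -, rfl⟩ hy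
  obtain ⟨lx, hlx⟩ := hconv x (hcl x hx')
  obtain ⟨ly, hly⟩ := hconv y (hcl y hy)
  -- By polarization this inner product is an affine function of ‖u m - y‖² - ‖u m - x‖². Both
  -- cluster points then give it the same value L, so ‖x - y‖² = 0.
  have hlim : ∃ L, Tendsto (fun m => inner ℝ (x - y) (u m)) atTop (𝓝 L) := by
    refine ⟨_, ((((hly.pow 2).sub (hlx.pow 2)).add_const (‖x‖ ^ 2 - ‖y‖ ^ 2)).div_const 2).congr
      fun m => ?_⟩
    rw [norm_sub_sq_real, norm_sub_sq_real, inner_sub_left, real_inner_comm x, real_inner_comm y]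
    ring
  obtain ⟨L, hL⟩ := hlim
  have hval : ∀ z, MapClusterPt (toWeakSpace ℝ H z) atTop (fun m => toWeakSpace ℝ H (u m)) →
      inner ℝ (x - y) z = L := fun z hz => by
    have h1 := hz.continuousAt_comp (continuous_inner_toWeakSpace_symm (x - y)).continuousAt
    have h2 : MapClusterPt (inner ℝ (x - y) z) atTop fun m => inner ℝ (x - y) (u m) := by
      simpa [Function.comp_def] using h1
    have h3 : (𝓝 (inner ℝ (x - y) z) ⊓ 𝓝 L).NeBot := h2.clusterPt.neBot.mono
      (inf_le_inf_left _ hL)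
    exact eq_of_nhds_neBot h3
  have h0 : inner ℝ (x - y) (x - y) = 0 := by
    rw [inner_sub_right, hval x hx', hval y hy, sub_self]
  rw [inner_self_eq_zero, sub_eq_zero] at h0
  rw [h0]

/-- Weak cluster points of a sequence lie in every closed convex set that eventually contains a
strongly asymptotic sequence. -/
theorem mem_of_mapClusterPt_toWeakSpace {C : Set H} (hC : Convex ℝ C) (hCc : IsClosed C)
    {u v : ℕ → H} (huv : Tendsto (fun m => v m - u m) atTop (𝓝 0)) (hv : ∀ᶠ m in atTop, v m ∈ C)
    {z : H} (hz : MapClusterPt (toWeakSpace ℝ H z) atTop fun m => toWeakSpace ℝ H (u m)) :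
    z ∈ C := by
  obtain ⟨U, hU, hUz⟩ := mapClusterPt_iff_ultrafilter.1 hz
  have h1 : Tendsto (fun m => toWeakSpace ℝ H (v m - u m)) U (𝓝 0) := by
    have := ((toWeakSpaceCLM ℝ H).continuous.tendsto 0).comp (huv.mono_left hU)
    simpa [Function.comp_def] using this
  have h2 : Tendsto (fun m => toWeakSpace ℝ H (v m)) U (𝓝 (toWeakSpace ℝ H z)) := by
    have := hUz.add h1
    rw [add_zero] at this
    refine this.congr fun m => ?_
    rw [← map_add, add_sub_cancel]
  have hcl : IsClosed (toWeakSpace ℝ H '' C) := by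
    rw [← hCc.closure_eq, hC.toWeakSpace_closure ℝ]
    exact isClosed_closure
  have := hcl.mem_of_tendsto h2 ((hv.filter_mono hU).mono fun m hm => mem_image_of_mem _ hm)
  simpa using this

end Weak

/-! ### From extended-real functions to real functions on the domain of G -/

section EReal

variable {H : Type*} [NormedAddCommGroup H] [InnerProductSpace ℝ H] {G : H → EReal}

theorem IsGammaZero.coe_toReal (hG : IsGammaZero G) {x : H} (hx : G x ≠ ⊤) :
    ((G x).toReal : EReal) = G x :=
  EReal.coe_toReal hx (hG.ne_bot x)

theorem IsGammaZero.convexOn_toReal (hG : IsGammaZero G) :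
    ConvexOn ℝ {x | G x ≠ ⊤} fun x => (G x).toReal := by
  have key : ∀ x, G x ≠ ⊤ → ∀ y, G y ≠ ⊤ → ∀ a b : ℝ, 0 ≤ a → 0 ≤ b → a + b = 1 →
      G (a • x + b • y) ≤ ((a * (G x).toReal + b * (G y).toReal : ℝ) : EReal) := by
    intro x hx y hy a b ha hb hab
    have := hG.convex x y a b ha hb hab
    rw [← hG.coe_toReal hx, ← hG.coe_toReal hy] at this
    exact_mod_cast this
  have hD : ∀ x, G x ≠ ⊤ → ∀ y, G y ≠ ⊤ → ∀ a b : ℝ, 0 ≤ a → 0 ≤ b → a + b = 1 →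
      G (a • x + b • y) ≠ ⊤ := fun x hx y hy a b ha hb hab =>
    ((key x hx y hy a b ha hb hab).trans_lt (EReal.coe_lt_top _)).ne
  refine ⟨fun x hx y hy a b ha hb hab => hD x hx y hy a b ha hb hab,
    fun x hx y hy a b ha hb hab => ?_⟩
  have := key x hx y hy a b ha hb hab
  rw [← hG.coe_toReal (hD x hx y hy a b ha hb hab)] at this
  exact_mod_cast this

theorem IsApproxProx.le_toReal (hG : IsGammaZero G) {c d : ℝ} (hc : 0 < c) {w v : H}
    (hv : IsApproxProx (fun x => (c : EReal) * G x) d w v) :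
    G v ≠ ⊤ ∧ ∀ x ∈ {x | G x ≠ ⊤}, c * (G v).toReal + 1 / 2 * ‖v - w‖ ^ 2 ≤
      c * (G x).toReal + 1 / 2 * ‖x - w‖ ^ 2 + d ^ 2 / 2 := by
  have key : ∀ x, G x ≠ ⊤ → (c : EReal) * G v + ((1 / 2 * ‖v - w‖ ^ 2 : ℝ) : EReal) ≤
      ((c * (G x).toReal + 1 / 2 * ‖x - w‖ ^ 2 + d ^ 2 / 2 : ℝ) : EReal) := by
    intro x hx
    have h1 := le_trans hv (add_le_add_left (iInf_le _ x) _)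
    beta_reduce at h1
    rw [← hG.coe_toReal hx] at h1
    exact_mod_cast h1
  have hvt : G v ≠ ⊤ := by
    obtain ⟨x, hx⟩ := hG.proper
    intro h
    have h1 := key x hx
    rw [h, EReal.coe_mul_top_of_pos hc, EReal.top_add_coe, top_le_iff] at h1
    exact EReal.coe_ne_top _ h1
  refine ⟨hvt, fun x hx => ?_⟩
  have h1 := key x hx
  rw [← hG.coe_toReal hvt] at h1
  exact_mod_cast h1

theorem IsGammaZero.coe_add_eq (hG : IsGammaZero G) (F : H → ℝ) {x : H} (hx : G x ≠ ⊤) :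
    (F x : EReal) + G x = ((F x + (G x).toReal : ℝ) : EReal) := by
  rw [EReal.coe_add, hG.coe_toReal hx]

theorem coe_add_ne_top_iff {α : Type*} {G : α → EReal} (F : α → ℝ) {x : α} : (F x : EReal) + G x ≠ ⊤ ↔ G x ≠ ⊤ := by
  refine ⟨fun h hx => h (by rw [hx, EReal.coe_add_top]), fun h => ?_⟩
  exact EReal.add_ne_top (EReal.coe_ne_top _) h

theorem IsGammaZero.mem_argmin_add_iff (hG : IsGammaZero G) (F : H → ℝ) {x : H} :
    x ∈ Argmin (fun x => (F x : EReal) + G x) ↔ G x ≠ ⊤ ∧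
      ∀ z ∈ {x | G x ≠ ⊤}, F x + (G x).toReal ≤ F z + (G z).toReal := by
  constructor
  · intro h
    have hx : G x ≠ ⊤ := by
      obtain ⟨y, hy⟩ := hG.proper
      rw [← coe_add_ne_top_iff F]
      exact ((h y).trans_lt ((coe_add_ne_top_iff F).2 hy).lt_top).ne
    refine ⟨hx, fun z hz => ?_⟩
    have := h z
    simp only [hG.coe_add_eq F hx, hG.coe_add_eq F hz] at this
    exact_mod_cast this
  · rintro ⟨hx, h⟩ z
    show (F x : EReal) + G x ≤ (F z : EReal) + G z
    by_cases hz : G z = ⊤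
    · rw [hz, EReal.coe_add_top]
      exact le_top
    · rw [hG.coe_add_eq F hx, hG.coe_add_eq F hz]
      exact_mod_cast h z hz

theorem IsGammaZero.isClosed_sublevel_add (hG : IsGammaZero G) {F : H → ℝ} (hF : Continuous F)
    (r : ℝ) : IsClosed {x | x ∈ {x | G x ≠ ⊤} ∧ F x + (G x).toReal ≤ r} := by
  have hlsc : LowerSemicontinuous fun x => (F x : EReal) + G x :=
    (continuous_coe_real_ereal.comp hF).lowerSemicontinuous.add' hG.lsc fun x =>
      EReal.continuousAt_add (Or.inl (EReal.coe_ne_top _)) (Or.inl (EReal.coe_ne_bot _))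
  convert hlsc.isClosed_preimage (r : EReal) using 1
  ext x
  simp only [mem_ofPred_eq, mem_preimage, mem_Iic]
  constructor
  · rintro ⟨hx, h⟩
    rw [hG.coe_add_eq F hx]
    exact_mod_cast h
  · intro h
    have hx : G x ≠ ⊤ := (coe_add_ne_top_iff F).1 (h.trans_lt (EReal.coe_lt_top _)).ne
    rw [hG.coe_add_eq F hx] at h
    exact ⟨hx, by exact_mod_cast h⟩

theorem Argmin.iInf_eq {α : Type*} {φ : α → EReal} {x : α} (hx : x ∈ Argmin φ) :
    ⨅ y, φ y = φ x :=
  le_antisymm (iInf_le _ _) (le_iInf hx)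

end EReal

/-! ### Energy inequalities for one forward-backward step -/

section Step

variable {H : Type*} [NormedAddCommGroup H] [InnerProductSpace ℝ H]
  {D : Set H} {g : H → ℝ} {c d : ℝ} {u v b : H}

/-- Expanding the squares around u leaves a constant that cancels; Cauchy–Schwarz turns the
perturbation b into the error c‖b‖. In use, p is the gradient of F at u. -/
theorem ConvexOn.forwardBackward_step (hg : ConvexOn ℝ D g) (hc : 0 ≤ c) (hd : 0 ≤ d)
    (hvD : v ∈ D) {p : H} (hv : ∀ x ∈ D, c * g v + 1 / 2 * ‖v - (u - c • (p + b))‖ ^ 2 ≤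
      c * g x + 1 / 2 * ‖x - (u - c • (p + b))‖ ^ 2 + d ^ 2 / 2) {x : H} (hx : x ∈ D) :
    c * (g v - g x + inner ℝ p (v - x)) + 1 / 2 * ‖v - u‖ ^ 2 + 1 / 2 * ‖v - x‖ ^ 2 ≤
      1 / 2 * ‖u - x‖ ^ 2 + d ^ 2 / 2 + (d + c * ‖b‖) * ‖v - x‖ := by
  have h1 := (hg.smul hc).add_sq_norm_le_of_approx_min (w := u - c • (p + b)) hd hvD
    (by simpa using hv) hx
  have h2 : ∀ z, ‖z - (u - c • (p + b))‖ ^ 2 =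
      ‖z - u‖ ^ 2 + 2 * (c * inner ℝ (p + b) (z - u)) + ‖c • (p + b)‖ ^ 2 := fun z => by
    rw [sub_sub_eq_add_sub, add_sub_right_comm, norm_add_sq_real, inner_smul_right,
      real_inner_comm]
  have h3 : inner ℝ (p + b) (v - u) - inner ℝ (p + b) (x - u) =
      inner ℝ p (v - x) + inner ℝ b (v - x) := by
    rw [← inner_sub_right, sub_sub_sub_cancel_right, inner_add_left]
  have h4 := mul_le_mul_of_nonneg_left (neg_le_of_abs_le (abs_real_inner_le_norm b (v - x))) hc
  rw [h2, h2, norm_sub_rev x u] at h1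
  simp only [smul_eq_mul] at h1
  have h5 : c * inner ℝ (p + b) (v - u) - c * inner ℝ (p + b) (x - u) =
      c * inner ℝ p (v - x) + c * inner ℝ b (v - x) := by
    rw [← mul_sub, h3, mul_add]
  linarith

variable [CompleteSpace H] {F : H → ℝ} {β : NNReal}

theorem ConvexOn.forwardBackward_gap_le (hF : ConvexOn ℝ univ F) (hFd : Differentiable ℝ F)
    (hL : LipschitzWith β (gradient F)) (hg : ConvexOn ℝ D g) (hc : 0 ≤ c) (hd : 0 ≤ d)
    (hvD : v ∈ D) (hv : ∀ x ∈ D, c * g v + 1 / 2 * ‖v - (u - c • (gradient F u + b))‖ ^ 2 ≤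
      c * g x + 1 / 2 * ‖x - (u - c • (gradient F u + b))‖ ^ 2 + d ^ 2 / 2) {x : H} (hx : x ∈ D) :
    c * (F v + g v - (F x + g x)) + 1 / 2 * (1 - c * β) * ‖v - u‖ ^ 2 + 1 / 2 * ‖v - x‖ ^ 2 ≤
      1 / 2 * ‖u - x‖ ^ 2 + d ^ 2 / 2 + (d + c * ‖b‖) * ‖v - x‖ := by
  have h1 := hg.forwardBackward_step hc hd hvD hv hx
  have h2 := le_add_inner_gradient_add_sq hFd hL u v
  have h3 := hF.add_inner_gradient_le hFd u x
  have h4 : inner ℝ (gradient F u) (v - u) - inner ℝ (gradient F u) (x - u) =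
      inner ℝ (gradient F u) (v - x) := by
    rw [← inner_sub_right, sub_sub_sub_cancel_right]
  have h5 : c * (F v - F x) ≤ c * (inner ℝ (gradient F u) (v - x) + β / 2 * ‖v - u‖ ^ 2) :=
    mul_le_mul_of_nonneg_left (by linarith) hc
  linarith

theorem ConvexOn.forwardBackward_residual_le (hβ : 0 < β) (hF : ConvexOn ℝ univ F)
    (hFd : Differentiable ℝ F) (hL : LipschitzWith β (gradient F)) (hg : ConvexOn ℝ D g)
    (hc : 0 ≤ c) (hd : 0 ≤ d) (hvD : v ∈ D)
    (hv : ∀ x ∈ D, c * g v + 1 / 2 * ‖v - (u - c • (gradient F u + b))‖ ^ 2 ≤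
      c * g x + 1 / 2 * ‖x - (u - c • (gradient F u + b))‖ ^ 2 + d ^ 2 / 2) {x : H} (hx : x ∈ D)
    (hmin : ∀ z ∈ D, F x + g x ≤ F z + g z) :
    1 / 2 * ‖v - u‖ ^ 2 + c * (1 / β * ‖gradient F u - gradient F x‖ ^ 2 -
      ‖v - u‖ * ‖gradient F u - gradient F x‖) + 1 / 2 * ‖v - x‖ ^ 2 ≤
      1 / 2 * ‖u - x‖ ^ 2 + d ^ 2 / 2 + (d + c * ‖b‖) * ‖v - x‖ := by
  have h1 := hg.forwardBackward_step hc hd hvD hv hx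
  have h2 := hg.sub_inner_gradient_le_of_isMinOn hFd hL hx hvD hmin
  have h3 := hF.sq_norm_sub_le_inner_gradient hβ hFd hL x u
  have h4 := neg_le_of_abs_le (abs_real_inner_le_norm (gradient F u - gradient F x) (v - u))
  have h5 : inner ℝ (gradient F u - gradient F x) (v - u) +
      inner ℝ (gradient F u - gradient F x) (u - x) =
      inner ℝ (gradient F u) (v - x) - inner ℝ (gradient F x) (v - x) := by
    rw [← inner_add_right, sub_add_sub_cancel, inner_sub_left]
  have h6 : c * (1 / β * ‖gradient F u - gradient F x‖ ^ 2 -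
      ‖v - u‖ * ‖gradient F u - gradient F x‖) ≤
      c * (g v - g x + inner ℝ (gradient F u) (v - x)) :=
    mul_le_mul_of_nonneg_left (by linarith) hc
  linarith

end Step

/-! ### Summability from the energy inequalities -/

section Sequences

theorem exists_pos_mul_add_sq_le {β c₀ c₁ : ℝ} (hβ : 0 < β) (h0 : 0 < c₀) (h01 : c₀ ≤ c₁)
    (h1 : c₁ < 2 / β) : ∃ κ > 0, ∀ c ∈ Icc c₀ c₁, ∀ p q : ℝ,
      κ * (p ^ 2 + q ^ 2) ≤ 1 / 2 * p ^ 2 + c * (1 / β * q ^ 2 - p * q) := by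
  set ρ := c₁ * β / 2 with hρ
  have hc1 : 0 < c₁ := h0.trans_le h01
  have hρ0 : 0 < ρ := by positivity
  have hρ1 : ρ < 1 := by
    rw [lt_div_iff₀ hβ] at h1
    linarith
  -- Young's inequality with any weight a in (ρ, 1) leaves both square coefficients positive; the
  -- midpoint is such a weight since c₁ < 2/β gives ρ < 1.
  set a := (1 + ρ) / 2 with ha
  have haρ : ρ < a := by linarith
  have ha1 : a < 1 := by linarith
  have ha0 : 0 < a := by linarith
  have hra : ρ / a < 1 := (div_lt_one ha0).2 haρ
  have hk2 : 0 < c₀ / β * (1 - ρ / a) := mul_pos (div_pos h0 hβ) (by linarith)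
  refine ⟨min ((1 - a) / 2) (c₀ / β * (1 - ρ / a)), lt_min (by linarith) hk2, ?_⟩
  intro c hc p q
  have hc0 : 0 < c := h0.trans_le hc.1
  have e1 := mul_le_mul_of_nonneg_right (min_le_left ((1 - a) / 2) (c₀ / β * (1 - ρ / a)))
    (sq_nonneg p)
  have e2 := mul_le_mul_of_nonneg_right (min_le_right ((1 - a) / 2) (c₀ / β * (1 - ρ / a)))
    (sq_nonneg q)
  have e3 : c₀ / β * (1 - ρ / a) ≤ c / β * (1 - ρ / a) := by
    have := hc.1
    have : 0 ≤ 1 - ρ / a := by linarith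
    gcongr
  have e4 : c * (p * q) ≤ a / 2 * p ^ 2 + c ^ 2 / (2 * a) * q ^ 2 := by
    have : a / 2 * p ^ 2 + c ^ 2 / (2 * a) * q ^ 2 - c * (p * q) = (a * p - c * q) ^ 2 / (2 * a) := by
      field_simp
      ring
    have : 0 ≤ (a * p - c * q) ^ 2 / (2 * a) := by positivity
    linarith
  have e5 : c ^ 2 / (2 * a) ≤ c / β * (ρ / a) := by
    have : c / β * (ρ / a) = c * c₁ / (2 * a) := by
      rw [hρ]
      field_simp
    rw [this, sq]
    have := hc.2
    gcongr
  have e6 := mul_le_mul_of_nonneg_right e3 (sq_nonneg q)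
  have e7 := mul_le_mul_of_nonneg_right e5 (sq_nonneg q)
  have e8 : c * (1 / β * q ^ 2 - p * q) = c / β * q ^ 2 - c * (p * q) := by ring
  rw [e8]
  linarith

theorem Summable.exists_bound {e : ℕ → ℝ} (hes : Summable e) :
    ∃ E, 0 ≤ E ∧ ∀ n, e n ≤ E := by
  obtain ⟨E, hE⟩ := hes.tendsto_atTop_zero.bddAbove_range
  exact ⟨max E 0, le_max_right _ _, fun n => (hE ⟨n, rfl⟩).trans (le_max_left _ _)⟩

theorem sq_le_of_le_convex_comb {a s r t : ℝ} (ha : 0 ≤ a) (ht : t ∈ Ioc (0 : ℝ) 1)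
    (h : a ≤ (1 - t) * s + t * r) : a ^ 2 ≤ (1 - t) * s ^ 2 + t * r ^ 2 := by
  have h1 := pow_le_pow_left₀ ha h 2
  nlinarith [mul_nonneg (mul_nonneg ht.1.le (sub_nonneg.2 ht.2)) (sq_nonneg (s - r))]

variable {s r d e τ : ℕ → ℝ}

/-- Quasi-Fejér monotonicity of relaxed sequences. -/
theorem quasiFejer {z : ℕ → ℝ} {t : ℝ} (hs : ∀ n, 0 ≤ s n) (hr : ∀ n, 0 ≤ r n)
    (hd : ∀ n, 0 ≤ d n) (hde : ∀ n, d n ≤ e n) (hz : ∀ n, 0 ≤ z n) (hes : Summable e)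
    (ht : 0 < t) (htτ : ∀ n, t ≤ τ n) (hτ : ∀ n, τ n ∈ Ioc (0 : ℝ) 1)
    (hsr : ∀ n, s (n + 1) ≤ (1 - τ n) * s n + τ n * r n)
    (h : ∀ n, z n + 1 / 2 * r n ^ 2 ≤ 1 / 2 * s n ^ 2 + d n ^ 2 / 2 + e n * r n) :
    Summable z ∧ (∃ l, Tendsto s atTop (𝓝 l)) ∧ ∃ M, ∀ n, s n ≤ M ∧ r n ≤ M := by
  have he : ∀ n, 0 ≤ e n := fun n => (hd n).trans (hde n)
  have hd2 : ∀ n, d n ^ 2 ≤ e n ^ 2 := fun n => pow_le_pow_left₀ (hd n) (hde n) 2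
  -- The energy inequality gives (r - e)² ≤ s² + 2e², hence r ≤ s + (1 + √2)e; 3 is a convenient
  -- bound.
  have hrs : ∀ n, r n ≤ s n + 3 * e n := by
    intro n
    by_contra! hlt
    nlinarith [h n, hz n, hd2 n, hs n, he n]
  have hs' : ∀ n, s (n + 1) ≤ s n + 3 * e n := fun n => by
    nlinarith [hsr n, hrs n, (hτ n).1, (hτ n).2, he n,
      mul_le_mul_of_nonneg_left (hrs n) (hτ n).1.le,
      mul_nonneg (sub_nonneg.2 (hτ n).2) (he n)]
  obtain ⟨-, l, hl⟩ := summable_and_tendsto_of_add_le (c := fun _ => 0) hs (fun _ => le_rfl)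
    (fun n => by linarith [he n]) (hes.mul_left 3) fun n => by linarith [hs' n]
  obtain ⟨R, hR⟩ := hl.bddAbove_range
  obtain ⟨E, hE0, hE⟩ := hes.exists_bound
  have hsM : ∀ n, s n ≤ R := fun n => hR ⟨n, rfl⟩
  have hrM : ∀ n, r n ≤ R + 3 * E := fun n => by linarith [hrs n, hsM n, hE n]
  refine ⟨?_, ⟨l, hl⟩, R + 3 * E, fun n => ⟨by linarith [hsM n], hrM n⟩⟩
  have hM0 : 0 ≤ R + 3 * E := (hr 0).trans (hrM 0)
  have := (summable_and_tendsto_of_add_le (a := fun n => s n ^ 2) (c := fun n => 2 * t * z n)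
    (e := fun n => (E + 2 * (R + 3 * E)) * e n) (fun n => sq_nonneg _)
    (fun n => mul_nonneg (by positivity) (hz n))
    (fun n => mul_nonneg (by positivity) (he n)) (hes.mul_left _) fun n => by
      have h1 := sq_le_of_le_convex_comb (hs (n + 1)) (hτ n) (hsr n)
      have h2 : e n ^ 2 ≤ E * e n := by
        rw [sq]
        exact mul_le_mul_of_nonneg_right (hE n) (he n)
      have h3 := mul_le_mul_of_nonneg_left (hrM n) (he n)
      have h4 := mul_le_mul_of_nonneg_right (htτ n) (hz n)
      have h5 : 0 ≤ (E + 2 * (R + 3 * E)) * e n := mul_nonneg (by positivity) (he n)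
      have h6 := mul_le_mul_of_nonneg_right (hτ n).2 h5
      have h7 := mul_le_mul_of_nonneg_left (h n) (hτ n).1.le
      have h8 : 1 / 2 * s n ^ 2 + d n ^ 2 / 2 + e n * r n ≤
          1 / 2 * s n ^ 2 + (E + 2 * (R + 3 * E)) * e n / 2 := by linarith [hd2 n]
      have h9 := mul_le_mul_of_nonneg_left h8 (hτ n).1.le
      linarith).1
  exact (summable_mul_left_iff (by positivity)).1 this

variable {p a c : ℕ → ℝ} {β c₀ M : ℝ}

/-- As c β ≤ 2, the coefficient of p² is at least -1/2, so that term can move to the right, where `p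
n ^ 2` will be summable. -/
theorem gap_le_of_energy (hr : ∀ n, 0 ≤ r n) (hd : ∀ n, 0 ≤ d n)
    (hde : ∀ n, d n ≤ e n) (hes : Summable e) (ha : ∀ n, 0 ≤ a n) (hc : ∀ n, c₀ ≤ c n)
    (hcβ : ∀ n, c n * β ≤ 2) (hM : ∀ n, s n ≤ M ∧ r n ≤ M)
    (h : ∀ n, c n * a n + 1 / 2 * (1 - c n * β) * p n ^ 2 + 1 / 2 * r n ^ 2 ≤
      1 / 2 * s n ^ 2 + d n ^ 2 / 2 + e n * r n) :
    ∃ C, 0 ≤ C ∧ ∀ n, c₀ * a n ≤ 1 / 2 * (s n ^ 2 - r n ^ 2) + 1 / 2 * p n ^ 2 + C * e n := by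
  obtain ⟨E, hE0, hE⟩ := hes.exists_bound
  have hM0 : 0 ≤ M := (hr 0).trans (hM 0).2
  refine ⟨E / 2 + M, by positivity, fun n => ?_⟩
  have he : 0 ≤ e n := (hd n).trans (hde n)
  have h1 : d n ^ 2 ≤ E * e n := (pow_le_pow_left₀ (hd n) (hde n) 2).trans <| by
    rw [sq]
    exact mul_le_mul_of_nonneg_right (hE n) he
  have h2 := mul_le_mul_of_nonneg_left (hM n).2 he
  have h3 := mul_le_mul_of_nonneg_right (hc n) (ha n)
  have h4 := mul_le_mul_of_nonneg_right (hcβ n) (sq_nonneg (p n))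
  linarith [h n]

/-- Boundedness by M and s - r ≤ p give s² - r² ≤ 2Mp and p² ≤ 2Mp, so a is O(p) + O(e), a sum of ℓ²
sequences. -/
theorem summable_sq_gap (hs : ∀ n, 0 ≤ s n) (hr : ∀ n, 0 ≤ r n) (hp : ∀ n, 0 ≤ p n)
    (he : ∀ n, 0 ≤ e n) (hes : Summable e) (hps : Summable fun n => p n ^ 2)
    (ha : ∀ n, 0 ≤ a n) (hc₀ : 0 < c₀) (hM : ∀ n, s n ≤ M ∧ r n ≤ M)
    (hsrp : ∀ n, s n ≤ r n + p n) (hpM : ∀ n, p n ≤ s n + r n) {C : ℝ}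
    (h : ∀ n, c₀ * a n ≤ 1 / 2 * (s n ^ 2 - r n ^ 2) + 1 / 2 * p n ^ 2 + C * e n) :
    Summable fun n => a n ^ 2 := by
  obtain ⟨E, hE0, hE⟩ := hes.exists_bound
  have hes2 : Summable fun n => e n ^ 2 :=
    Summable.of_nonneg_of_le (fun n => sq_nonneg _) (fun n => by
      rw [sq]
      exact mul_le_mul_of_nonneg_right (hE n) (he n)) (hes.mul_left E)
  have hM0 : 0 ≤ M := (hr 0).trans (hM 0).2
  have key : ∀ n, c₀ ^ 2 * a n ^ 2 ≤ 2 * (2 * M) ^ 2 * p n ^ 2 + 2 * C ^ 2 * e n ^ 2 := by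
    intro n
    have h1 : s n ^ 2 - r n ^ 2 ≤ 2 * M * p n := by
      have h2 : s n ^ 2 - r n ^ 2 = (s n - r n) * (s n + r n) := by ring
      have h3 : (s n - r n) * (s n + r n) ≤ p n * (s n + r n) :=
        mul_le_mul_of_nonneg_right (by linarith [hsrp n]) (by linarith [hs n, hr n])
      have h4 : p n * (s n + r n) ≤ p n * (2 * M) :=
        mul_le_mul_of_nonneg_left (by linarith [(hM n).1, (hM n).2]) (hp n)
      linarith
    have h5 : p n ^ 2 ≤ 2 * M * p n := by
      rw [sq]
      exact mul_le_mul_of_nonneg_right (by linarith [hpM n, (hM n).1, (hM n).2]) (hp n)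
    have h6 : c₀ * a n ≤ 2 * M * p n + C * e n := by linarith [h n]
    have h7 := pow_le_pow_left₀ (mul_nonneg hc₀.le (ha n)) h6 2
    nlinarith [sq_nonneg (2 * M * p n - C * e n)]
  have := Summable.of_nonneg_of_le (fun n => by positivity) key
    ((hps.mul_left (2 * (2 * M) ^ 2)).add (hes2.mul_left (2 * C ^ 2)))
  exact (summable_mul_left_iff (by positivity)).1 this

/-- Convexity of the square gives s (n+1)² ≤ r² + (1 - τ)M², so s² - r² telescopes up to a summable
error. -/
theorem summable_gap (hs : ∀ n, 0 ≤ s n) (he : ∀ n, 0 ≤ e n) (hes : Summable e) (hps : Summable fun n => p n ^ 2)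
    (ha : ∀ n, 0 ≤ a n) (hc₀ : 0 < c₀) (hM : ∀ n, s n ≤ M ∧ r n ≤ M)
    (hτ : ∀ n, τ n ∈ Ioc (0 : ℝ) 1) (hτs : Summable fun n => 1 - τ n)
    (hsr : ∀ n, s (n + 1) ≤ (1 - τ n) * s n + τ n * r n) {C : ℝ} (hC : 0 ≤ C)
    (h : ∀ n, c₀ * a n ≤ 1 / 2 * (s n ^ 2 - r n ^ 2) + 1 / 2 * p n ^ 2 + C * e n) :
    Summable a := by
  have := (summable_and_tendsto_of_add_le (a := fun n => 1 / 2 * s n ^ 2)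
    (c := fun n => c₀ * a n)
    (e := fun n => 1 / 2 * M ^ 2 * (1 - τ n) + 1 / 2 * p n ^ 2 + C * e n)
    (fun n => by positivity) (fun n => mul_nonneg hc₀.le (ha n))
    (fun n => by
      have := sub_nonneg.2 (hτ n).2
      have := he n
      positivity)
    (((hτs.mul_left _).add (hps.mul_left _)).add (hes.mul_left _)) fun n => by
      have h1 := sq_le_of_le_convex_comb (hs (n + 1)) (hτ n) (hsr n)
      have h2 := pow_le_pow_left₀ (hs n) (hM n).1 2
      have h3 := mul_le_mul_of_nonneg_left h2 (sub_nonneg.2 (hτ n).2)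
      have h4 := mul_nonneg (sub_nonneg.2 (hτ n).2) (sq_nonneg (r n))
      linarith [h n]).1
  exact (summable_mul_left_iff hc₀.ne').1 this

end Sequences

/-! ### Passing from gaps at v to gaps at u -/

section Relaxation

variable {a h τ e : ℕ → ℝ} {t : ℝ}

/-- Squaring the recursion by convexity gives a (1 - t)-contraction for h² with summable error a².
-/
theorem tendsto_zero_of_relaxation (hh : ∀ n, 0 ≤ h n) (ht : 0 < t)
    (htτ : ∀ n, t ≤ τ n) (hτ : ∀ n, τ n ∈ Ioc (0 : ℝ) 1) (has : Summable fun n => a n ^ 2)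
    (hrec : ∀ n, h (n + 1) ≤ (1 - τ n) * h n + τ n * a n) : Tendsto h atTop (𝓝 0) := by
  have h1 : Summable fun n => h n ^ 2 :=
    summable_of_le_contraction ht (fun n => sq_nonneg _) (fun n => sq_nonneg _) has fun n => by
      have h2 := sq_le_of_le_convex_comb (hh (n + 1)) (hτ n) (hrec n)
      have h3 := mul_le_mul_of_nonneg_right (htτ n) (sq_nonneg (h n))
      have h4 := mul_le_mul_of_nonneg_right (hτ n).2 (sq_nonneg (a n))
      linarith
  have h2 := (Real.continuous_sqrt.tendsto 0).comp h1.tendsto_atTop_zero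
  rw [Real.sqrt_zero] at h2
  exact h2.congr fun n => Real.sqrt_sq (hh n)

theorem summable_of_relaxation (hh : ∀ n, 0 ≤ h n) (ha : ∀ n, 0 ≤ a n) (ht : 0 < t)
    (htτ : ∀ n, t ≤ τ n) (hτ : ∀ n, τ n ∈ Ioc (0 : ℝ) 1) (has : Summable a)
    (hrec : ∀ n, h (n + 1) ≤ (1 - τ n) * h n + τ n * a n) : Summable h :=
  summable_of_le_contraction ht hh ha has fun n => by
    have h3 := mul_le_mul_of_nonneg_right (htτ n) (hh n)
    have h4 := mul_le_mul_of_nonneg_right (hτ n).2 (ha n)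
    linarith [hrec n]

theorem tendsto_mul_of_relaxation (hh : ∀ n, 0 ≤ h n) (he : ∀ n, 0 ≤ e n)
    (hτ : ∀ n, τ n ∈ Ioc (0 : ℝ) 1) (hhs : Summable h)
    (hes : Summable fun n : ℕ => ((n : ℝ) + 1) * e n)
    (hrec : ∀ n, h (n + 1) ≤ (1 - τ n) * h n + τ n * a n) (hah : ∀ n, a n ≤ h n + e n) :
    Tendsto (fun n : ℕ => (n : ℝ) * h n) atTop (𝓝 0) :=
  tendsto_mul_of_summable_of_almost_antitone hh he hhs hes fun n => by
    have h3 := mul_le_mul_of_nonneg_left (hah n) (hτ n).1.le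
    have h4 := mul_le_mul_of_nonneg_right (hτ n).2 (he n)
    linarith [hrec n]

end Relaxation

/-! ### The convergence theorem -/

theorem theorem2 {H : Type*} [NormedAddCommGroup H] [InnerProductSpace ℝ H] [CompleteSpace H]
    (F : H → ℝ) (β : NNReal) (hβ : 0 < β)
    (hFconv : ConvexOn ℝ univ F) (hFdiff : Differentiable ℝ F)
    (hFlip : LipschitzWith β (gradient F))
    (G : H → EReal) (hG : IsGammaZero G)
    (J : H → EReal) (hJ : J = fun x => (F x : EReal) + G x)
    (hArg : (Argmin J).Nonempty)
    (γ : ℕ → ℝ) (hγpos : ∀ m, 0 < γ m) (hγinf : 0 < ⨅ m, γ m)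
    (hγbdd : BddAbove (range γ)) (hγsup : ⨆ m, γ m < 2 / (β : ℝ))
    (τ : ℕ → ℝ) (hτ : ∀ m, τ m ∈ Ioc (0 : ℝ) 1) (hτinf : 0 < ⨅ m, τ m)
    (δ : ℕ → ℝ) (hδ : ∀ m, 0 ≤ δ m) (hδsum : Summable δ)
    (b : ℕ → H) (hbsum : Summable fun m => ‖b m‖)
    (u v : ℕ → H)
    (hv : ∀ m, IsApproxProx (fun x => (γ m : EReal) * G x) (δ m)
      (u m - γ m • (gradient F (u m) + b m)) (v m))
    (hu : ∀ m, u (m + 1) = u m + τ m • (v m - u m)) :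
    -- weak convergence to a minimizer
    (∃ x ∈ Argmin J,
      Tendsto (fun m => toWeakSpace ℝ H (u m)) atTop (𝓝 (toWeakSpace ℝ H x))) ∧
    -- square summability of the gradient differences and of the residuals
    (∀ x ∈ Argmin J, Summable fun m => ‖gradient F (u m) - gradient F x‖ ^ 2) ∧
    (Summable fun m => ‖v m - u m‖ ^ 2) ∧
    -- the iterates stay in the domain of `J` once they have entered it, and are then minimizing
    (∀ k, J (u k) ≠ ⊤ →
      (∀ m, k ≤ m → J (u m) ≠ ⊤) ∧ Tendsto (fun m => J (u m)) atTop (𝓝 (⨅ y, J y))) ∧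
    -- the objective gaps at `v m` are finite and square summable
    ((∀ m, J (v m) ≠ ⊤) ∧ Summable fun m => |objGap J (v m)| ^ 2) ∧
    -- summability of the objective gaps
    ((Summable fun m => 1 - τ m) →
      (Summable fun m => objGap J (v m)) ∧
      ∀ k, J (u k) ≠ ⊤ → Summable fun m => objGap J (u (k + m))) ∧
    -- the rate `o(1/m)`
    ((Summable fun m => 1 - τ m) → (Summable fun m : ℕ => (m : ℝ) * δ m) →
      (Summable fun m : ℕ => (m : ℝ) * ‖b m‖) →
      ∀ k, J (u k) ≠ ⊤ →
        (fun m => objGap J (u m)) =o[atTop] fun m : ℕ => 1 / (m : ℝ)) := by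
  have hβ' : (0 : ℝ) < β := hβ
  obtain ⟨xs, hxs⟩ := hArg
  have hinf : ⨅ y, J y = J xs := Argmin.iInf_eq hxs
  subst hJ
  have hArg := fun x => hG.mem_argmin_add_iff F (x := x)
  have htop := fun x => coe_add_ne_top_iff (G := G) F (x := x)
  have hcoe := fun x => hG.coe_add_eq F (x := x)
  set J : H → EReal := fun x => (F x : EReal) + G x
  set D : Set H := {x | G x ≠ ⊤} with hD
  set g : H → ℝ := fun x => (G x).toReal
  have hg : ConvexOn ℝ D g := hG.convexOn_toReal
  have hj : ConvexOn ℝ D fun x => F x + g x := (hFconv.subset (subset_univ _) hg.1).add hg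
  have hxsD : xs ∈ D := ((hArg xs).1 hxs).1
  have hmin : ∀ z ∈ D, F xs + g xs ≤ F z + g z := ((hArg xs).1 hxs).2
  have hgap : ∀ z ∈ D, objGap J z = F z + g z - (F xs + g xs) := fun z hz => by
    unfold objGap
    rw [hinf]
    show (((F z : EReal) + G z) - ((F xs : EReal) + G xs)).toReal = _
    rw [hcoe z hz, hcoe xs hxsD, ← EReal.coe_sub, EReal.toReal_coe]
  -- parameters
  obtain ⟨c₀, hc₀, hc₀γ⟩ : ∃ c₀ > 0, ∀ m, c₀ ≤ γ m :=
    ⟨_, hγinf, fun m => ciInf_le ⟨0, by rintro _ ⟨i, rfl⟩; exact (hγpos i).le⟩ m⟩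
  obtain ⟨t, ht, htτ⟩ : ∃ t > 0, ∀ m, t ≤ τ m :=
    ⟨_, hτinf, fun m => ciInf_le ⟨0, by rintro _ ⟨i, rfl⟩; exact (hτ i).1.le⟩ m⟩
  have hγle : ∀ m, γ m ≤ ⨆ m, γ m := fun m => le_ciSup hγbdd m
  have hγβ : ∀ m, γ m * β ≤ 2 := fun m => by
    rw [← le_div_iff₀ hβ']
    exact (hγle m).trans hγsup.le
  obtain ⟨κ, hκ, hquad⟩ := exists_pos_mul_add_sq_le hβ' hc₀ ((hc₀γ 0).trans (hγle 0)) hγsup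
  set e : ℕ → ℝ := fun m => δ m + γ m * ‖b m‖ with he_def
  have hδe : ∀ m, δ m ≤ e m := fun m =>
    le_add_of_nonneg_right (mul_nonneg (hγpos m).le (norm_nonneg _))
  have he : ∀ m, 0 ≤ e m := fun m => (hδ m).trans (hδe m)
  have hes_of : ∀ w : ℕ → ℝ, (∀ m, 0 ≤ w m) → (Summable fun m => w m * δ m) →
      (Summable fun m => w m * ‖b m‖) → Summable fun m => w m * e m := by
    intro w hw h1 h2
    refine Summable.of_nonneg_of_le (fun m => mul_nonneg (hw m) (he m)) (fun m => ?_)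
      (h1.add (h2.mul_left (⨆ m, γ m)))
    have h3 := mul_le_mul_of_nonneg_right (hγle m) (mul_nonneg (hw m) (norm_nonneg (b m)))
    simp only [he_def]
    linarith
  have hes : Summable e := by
    simpa using hes_of (fun _ => 1) (fun _ => zero_le_one) (by simpa using hδsum)
      (by simpa using hbsum)
  -- one step of the algorithm
  have hvD : ∀ m, v m ∈ D := fun m => (IsApproxProx.le_toReal hG (hγpos m) (hv m)).1
  have hvle := fun m => (IsApproxProx.le_toReal hG (hγpos m) (hv m)).2
  have hA : ∀ m, ∀ x ∈ D, γ m * (F (v m) + g (v m) - (F x + g x)) +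
      1 / 2 * (1 - γ m * β) * ‖v m - u m‖ ^ 2 + 1 / 2 * ‖v m - x‖ ^ 2 ≤
      1 / 2 * ‖u m - x‖ ^ 2 + δ m ^ 2 / 2 + e m * ‖v m - x‖ := fun m x hx =>
    hFconv.forwardBackward_gap_le hFdiff hFlip hg (hγpos m).le (hδ m) (hvD m) (hvle m) hx
  have hsr : ∀ x m, ‖u (m + 1) - x‖ ≤ (1 - τ m) * ‖u m - x‖ + τ m * ‖v m - x‖ := by
    intro x m
    have h1 : u (m + 1) - x = (1 - τ m) • (u m - x) + τ m • (v m - x) := by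
      rw [hu]
      module
    rw [h1]
    refine (norm_add_le _ _).trans_eq ?_
    rw [norm_smul, norm_smul, Real.norm_of_nonneg (hτ m).1.le,
      Real.norm_of_nonneg (sub_nonneg.2 (hτ m).2)]
  have hfejer : ∀ x ∈ Argmin J,
      (Summable fun m => κ * (‖v m - u m‖ ^ 2 + ‖gradient F (u m) - gradient F x‖ ^ 2)) ∧
      (∃ l, Tendsto (fun m => ‖u m - x‖) atTop (𝓝 l)) ∧
      ∃ M, ∀ m, ‖u m - x‖ ≤ M ∧ ‖v m - x‖ ≤ M := fun x hx => by
    refine quasiFejer (fun m => norm_nonneg _) (fun m => norm_nonneg _) hδ hδe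
      (fun m => by positivity) hes ht htτ hτ (hsr x) fun m => ?_
    have h1 := hFconv.forwardBackward_residual_le hβ hFdiff hFlip hg (hγpos m).le (hδ m) (hvD m)
      (hvle m) ((hArg x).1 hx).1 ((hArg x).1 hx).2
    have h2 := hquad (γ m) ⟨hc₀γ m, hγle m⟩ ‖v m - u m‖ ‖gradient F (u m) - gradient F x‖
    linarith
  have hsumadd := fun x hx => (summable_mul_left_iff hκ.ne').1 (hfejer x hx).1
  have hgrad : ∀ x ∈ Argmin J, Summable fun m => ‖gradient F (u m) - gradient F x‖ ^ 2 :=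
    fun x hx => (hsumadd x hx).of_nonneg_of_le (fun m => sq_nonneg _)
      fun m => le_add_of_nonneg_left (sq_nonneg _)
  have hres : Summable fun m => ‖v m - u m‖ ^ 2 :=
    (hsumadd xs hxs).of_nonneg_of_le (fun m => sq_nonneg _)
      fun m => le_add_of_nonneg_right (sq_nonneg _)
  -- objective gaps
  obtain ⟨M, hM⟩ := (hfejer xs hxs).2.2
  set a : ℕ → ℝ := fun m => F (v m) + g (v m) - (F xs + g xs) with ha_def
  have ha : ∀ m, 0 ≤ a m := fun m => sub_nonneg.2 (hmin _ (hvD m))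
  obtain ⟨C, hC, hgapC⟩ := gap_le_of_energy (fun m => norm_nonneg (v m - xs)) hδ hδe hes ha hc₀γ
    hγβ hM fun m => hA m xs hxsD
  have ha2 : Summable fun m => a m ^ 2 :=
    summable_sq_gap (fun m => norm_nonneg (u m - xs)) (fun m => norm_nonneg (v m - xs))
      (fun m => norm_nonneg (v m - u m)) he hes hres ha hc₀ hM
      (fun m => by
        have := norm_sub_le_norm_sub_add_norm_sub (u m) (v m) xs
        rw [norm_sub_rev (u m) (v m)] at this
        linarith)
      (fun m => by
        have := norm_sub_le_norm_sub_add_norm_sub (v m) xs (u m)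
        rw [norm_sub_rev xs (u m)] at this
        linarith) hgapC
  have ha1 : (Summable fun m => 1 - τ m) → Summable a := fun hτs =>
    summable_gap (fun m => norm_nonneg (u m - xs)) he hes hres ha hc₀ hM hτ hτs
      (hsr xs) hC hgapC
  have hconvex : ∀ m, u (m + 1) = (1 - τ m) • u m + τ m • v m := fun m => by
    rw [hu]
    module
  have huD : ∀ k, u k ∈ D → ∀ m, u (k + m) ∈ D := fun k hk m => by
    induction m with
    | zero => exact hk
    | succ m ih =>
      rw [← add_assoc, hconvex]
      exact hg.1 ih (hvD _) (sub_nonneg.2 (hτ _).2) (hτ _).1.le (by ring)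
  set h : ℕ → ℝ := fun m => F (u m) + g (u m) - (F xs + g xs) with hh_def
  have hh : ∀ k, u k ∈ D → ∀ m, 0 ≤ h (k + m) := fun k hk m => sub_nonneg.2 (hmin _ (huD k hk m))
  have hrec : ∀ k, u k ∈ D → ∀ m,
      h (k + (m + 1)) ≤ (1 - τ (k + m)) * h (k + m) + τ (k + m) * a (k + m) := fun k hk m => by
    have h1 := hj.2 (huD k hk m) (hvD (k + m)) (sub_nonneg.2 (hτ (k + m)).2) (hτ (k + m)).1.le
      (by ring)
    rw [← hconvex] at h1
    simp only [smul_eq_mul] at h1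
    simp only [hh_def, ha_def, ← add_assoc]
    linarith
  have hshift : ∀ {f : ℕ → ℝ} (k : ℕ), Summable f → Summable fun m => f (k + m) :=
    fun {f} k hf => hf.comp_injective (add_right_injective k)
  have hh1 : (Summable fun m => 1 - τ m) → ∀ k, u k ∈ D → Summable fun m => h (k + m) :=
    fun hτs k hk => summable_of_relaxation (hh k hk) (fun m => ha (k + m)) ht
      (fun m => htτ (k + m)) (fun m => hτ (k + m)) (hshift k (ha1 hτs)) (hrec k hk)
  refine ⟨?_, hgrad, hres, ?_, ⟨fun m => (htop _).2 (hvD m), ?_⟩, fun hτs => ⟨?_, ?_⟩, ?_⟩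
  · -- weak convergence
    refine exists_tendsto_toWeakSpace ⟨xs, hxs⟩ (fun x hx => (hfejer x hx).2.1) fun z hz => ?_
    have hsq := (Real.continuous_sqrt.tendsto 0).comp hres.tendsto_atTop_zero
    have hsqa := (Real.continuous_sqrt.tendsto 0).comp ha2.tendsto_atTop_zero
    rw [Real.sqrt_zero] at hsq hsqa
    have huv : Tendsto (fun m => v m - u m) atTop (𝓝 0) :=
      tendsto_zero_iff_norm_tendsto_zero.2 (hsq.congr fun m => Real.sqrt_sq (norm_nonneg _))
    have ha0 : Tendsto a atTop (𝓝 0) := hsqa.congr fun m => Real.sqrt_sq (ha m)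
    have hlevel : ∀ ε > 0, z ∈ {x | x ∈ D ∧ F x + g x ≤ F xs + g xs + ε} := fun ε hε => by
      refine mem_of_mapClusterPt_toWeakSpace (hj.convex_le _)
        (hG.isClosed_sublevel_add hFdiff.continuous _) huv ?_ hz
      filter_upwards [ha0.eventually (gt_mem_nhds hε)] with m hm
      exact ⟨hvD m, by simp only [ha_def] at hm; linarith⟩
    refine (hArg z).2 ⟨(hlevel 1 one_pos).1, fun y hy => le_trans ?_ (hmin y hy)⟩
    exact le_of_forall_pos_le_add fun ε hε => (hlevel ε hε).2
  · intro k hk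
    have hk' : u k ∈ D := (htop _).1 hk
    refine ⟨fun m hm => ?_, ?_⟩
    · obtain ⟨n, rfl⟩ := Nat.exists_eq_add_of_le hm
      exact (htop _).2 (huD k hk' n)
    · have h0 : Tendsto (fun m => h (k + m)) atTop (𝓝 0) :=
        tendsto_zero_of_relaxation (hh k hk') ht (fun m => htτ (k + m))
          (fun m => hτ (k + m)) (hshift k ha2) (hrec k hk')
      have h1 : Tendsto (fun m => ((h (k + m) + (F xs + g xs) : ℝ) : EReal)) atTop
          (𝓝 ((0 + (F xs + g xs) : ℝ) : EReal)) :=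
        (continuous_coe_real_ereal.tendsto _).comp (h0.add_const _)
      rw [zero_add, ← hcoe xs hxsD] at h1
      rw [hinf, ← tendsto_add_atTop_iff_nat k]
      refine h1.congr fun m => ?_
      rw [add_comm m k]
      show _ = (F (u (k + m)) : EReal) + G (u (k + m))
      rw [hcoe _ (huD k hk' m)]
      simp [hh_def, g]
  · exact ha2.congr fun m => by rw [hgap _ (hvD m), sq_abs]
  · exact (ha1 hτs).congr fun m => (hgap _ (hvD m)).symm
  · intro k hk
    have hk' : u k ∈ D := (htop _).1 hk
    exact (hh1 hτs k hk').congr fun m => (hgap _ (huD k hk' m)).symm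
  · intro hτs hδs hbs k hk
    have hk' : u k ∈ D := (htop _).1 hk
    obtain ⟨E, hE0, hE⟩ := hes.exists_bound
    have hM0 : 0 ≤ M := (norm_nonneg _).trans (hM 0).1
    -- Energy inequality at x = u n: the ‖v n - u n‖² terms add up to (2 - γβ)/2 ≥ 0 times the
    -- square and are dropped. The constant comes from δ² ≤ E e and ‖v n - u n‖ ≤ 2M.
    have hdecr : ∀ m, a (k + m) ≤ h (k + m) + (E / 2 + 2 * M) / c₀ * e (k + m) := by
      intro m
      have h1 := hA (k + m) _ (huD k hk' m)
      set n := k + m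
      have h2 : δ n ^ 2 ≤ E * e n := (pow_le_pow_left₀ (hδ n) (hδe n) 2).trans <| by
        rw [sq]
        exact mul_le_mul_of_nonneg_right (hE n) (he n)
      have h3 : ‖v n - u n‖ ≤ 2 * M := by
        have := norm_sub_le_norm_sub_add_norm_sub (v n) xs (u n)
        rw [norm_sub_rev xs (u n)] at this
        linarith [(hM n).1, (hM n).2]
      have h4 := mul_le_mul_of_nonneg_left h3 (he n)
      have h5 := mul_le_mul_of_nonneg_right (hγβ n) (sq_nonneg ‖v n - u n‖)
      rw [sub_self, norm_zero] at h1
      have h6 : γ n * (a n - h n) ≤ (E / 2 + 2 * M) * e n := by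
        simp only [ha_def, hh_def]
        linarith
      have h7 : c₀ * (a n - h n) ≤ (E / 2 + 2 * M) * e n := by
        -- Replacing γ n by the smaller c₀ is legitimate only for a nonnegative difference; a
        -- negative one is trivial.
        rcases le_total 0 (a n - h n) with h8 | h8
        · exact (mul_le_mul_of_nonneg_right (hc₀γ n) h8).trans h6
        · exact (mul_nonpos_of_nonneg_of_nonpos hc₀.le h8).trans
            (mul_nonneg (by positivity) (he n))
      rw [div_mul_eq_mul_div, ← sub_le_iff_le_add', le_div_iff₀ hc₀]
      linarith
    have hesum : Summable fun m : ℕ => ((m : ℝ) + 1) * ((E / 2 + 2 * M) / c₀ * e (k + m)) := by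
      have h1 := ((hes_of (fun m => (m : ℝ)) (fun m => m.cast_nonneg) hδs hbs).add hes)
      refine ((hshift k h1).mul_left ((E / 2 + 2 * M) / c₀)).of_nonneg_of_le
        (fun m => mul_nonneg (by positivity) (mul_nonneg (by positivity) (he _))) fun m => ?_
      have h2 : 0 ≤ (E / 2 + 2 * M) / c₀ * (k * e (k + m)) :=
        mul_nonneg (by positivity) (mul_nonneg k.cast_nonneg (he _))
      push_cast
      linarith
    have hsum := hh1 hτs k hk'
    have h0 := tendsto_mul_of_relaxation (hh k hk')
      (fun m => mul_nonneg (by positivity) (he (k + m))) (fun m => hτ (k + m)) hsum hesum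
      (hrec k hk') hdecr
    -- The shift changes the weight m into m + k; the extra term k h tends to 0 by summability.
    have h1 : Tendsto (fun m : ℕ => ((m + k : ℕ) : ℝ) * objGap J (u (m + k))) atTop (𝓝 0) := by
      have h2 := h0.add (hsum.tendsto_atTop_zero.const_mul (k : ℝ))
      rw [mul_zero, add_zero] at h2
      refine h2.congr fun m => ?_
      rw [add_comm m k, hgap _ (huD k hk' m)]
      push_cast
      ring
    have h2 : Tendsto (fun m : ℕ => (m : ℝ) * objGap J (u m)) atTop (𝓝 0) :=
      (tendsto_add_atTop_iff_nat k).1 h1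
    refine (Asymptotics.isLittleO_iff_tendsto' ?_).2 (h2.congr fun m => ?_)
    · filter_upwards [eventually_gt_atTop 0] with m hm h3
      have : (0 : ℝ) < 1 / m := by positivity
      exact absurd h3 this.ne'
    · rw [div_div_eq_mul_div, div_one, mul_comm]
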